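/- Fix a real number $A$, an integer $d\ge 0$ and a real number $c>0$. Then there is a constant $C>0$, depending only on $A,d,c$, such that the following holds for all integers $M_0\ge 1$ and $N\ge 3$ with $N\le A\,M_0^{d}$. Let $R=M_0 2^{K}$ with $K$ an integer $\ge 0$ such that $R\ge 4N$, and let each of $N$ balls $x$ have two hash values $h_1(x),h_2(x)$, all $2N$ hash values being independent and uniformly distributed on $\{0,1,\dots,R-1\}$. Start with $M_0$ empty bins and insert the $N$ balls one after another. When there are $m$ bins, a newly inserted ball $x$ is placed into the emptier of the bins $h_1(x) \bmod m$ and $h_2(x)\bmod m$ (ties are broken arbitrarily). Whenever the current number $n$ of balls exceeds $m/4$, where $m$ is the current number of bins, the number of bins is doubled (repeatedly, if necessary, until $n\le m/4$) before the next insertion; when it goes from $m$ to $2m$, each bin $i$ splits into the bins $i$ and $m+i$, and a ball that was placed by its hash value $h_j(x)$ is from then on in bin $h_j(x)\bmod 2m$. Then, with probability at least $1-1/N^{c}$, at every moment of this process (after every insertion and after every doubling), and for every way of breaking ties, the fullest bin contains at most $C\log\log N$ balls. -/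

import Mathlib

open MeasureTheory ProbabilityTheory

namespace SplittingBins

/-- The hash values of `N` balls: ball `x` has the two hash values `H x 0` and `H x 1`. -/
abbrev Hashes (N : ℕ) : Type := Fin N → Fin 2 → ℕ

/-- A state of the system: the current number of bins, the current number of balls (the balls
`0, …, balls - 1` are present), and for every present ball which of its two hash values it was
placed by. The values of `choice` at balls that are not present have no meaning. -/
structure State (N : ℕ) where
  bins : ℕ
  balls : ℕ
  choice : Fin N → Fin 2

/-- The bin to which the `j`-th hash value of ball `x` points when there are `m` bins. -/
def binOf {N : ℕ} (H : Hashes N) (m : ℕ) (x : Fin N) (j : Fin 2) : ℕ := H x j % m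

/-- The number of balls in bin `i`. A present ball lies in the bin to which the hash value that it
was placed by points under the current number of bins; so when the number of bins goes from `m` to
`2 * m`, a ball of bin `i` is in bin `i` or in bin `m + i` afterwards. -/
def load {N : ℕ} (H : Hashes N) (s : State N) (i : ℕ) : ℕ :=
  (Finset.univ.filter fun x : Fin N =>
    (x : ℕ) < s.balls ∧ binOf H s.bins x (s.choice x) = i).card

/-- The number of balls in the fullest bin. -/
def fullest {N : ℕ} (H : Hashes N) (s : State N) : ℕ :=
  (Finset.range s.bins).sup (load H s)

/-- The start: `M₀` empty bins. -/
def start (M₀ N : ℕ) : State N := ⟨M₀, 0, fun _ => 0⟩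

/-- One step of the process. If the number of balls exceeds a quarter of the number of bins, the
bins double. Otherwise the next ball (if any is left) is inserted by power-of-two-choices: it goes
to one of its two bins that is at most as full as the other one, ties being broken arbitrarily. -/
inductive Step {N : ℕ} (H : Hashes N) : State N → State N → Prop
  | double (s : State N) (hs : s.bins < 4 * s.balls) :
      Step H s ⟨2 * s.bins, s.balls, s.choice⟩
  | insert (s : State N) (hs : 4 * s.balls ≤ s.bins) (hN : s.balls < N) (j : Fin 2)
      (hj : ∀ j' : Fin 2, load H s (binOf H s.bins ⟨s.balls, hN⟩ j) ≤
        load H s (binOf H s.bins ⟨s.balls, hN⟩ j')) :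
      Step H s ⟨s.bins, s.balls + 1, Function.update s.choice ⟨s.balls, hN⟩ j⟩

/-- The states that occur at some moment of the process started with `M₀` empty bins. -/
def Occurs {N : ℕ} (M₀ : ℕ) (H : Hashes N) (s : State N) : Prop :=
  Relation.ReflTransGen (Step H) (start M₀ N) s

end SplittingBins

namespace SplittingBins

/-! The proof is a witness tree argument. The number of bins at an insertion depends only on the
number of balls present, so every hit between two balls is a congruence of hash values to a fixed
modulus. Since each modulus divides the later ones, balls that share a bin shared it ever since both
were present; hence the `i`-th oldest ball of a bin (from 0) has height above `i`. When a ball of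
height `h` is inserted, the bin it rejects has at least `h - 1` balls, with heights above `0, …, h -
2` (`exists_hits`). Iterating, a ball of height above `k` is the root of a binomial tree of hits
with `2 ^ k` nodes.

If the balls of such a tree are distinct, its hits behave as if independent. A node offers at most
`2 * y` hash values of older balls, each hit with probability `1 / m`, where `4 * y ≤ m`; so each
edge costs a factor `1 / 2`, and `2 ^ k` of order `log N` suffices.

Balls may repeat, however. A bin with more than `k + e` balls gives `e` such trees below one ball.
If all of them have repeats, each is explored up to its first ball seen before (`exists_repeats`).
This gives `e` further congruences, of probability at most `1 / M₀` each, against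
polylogarithmically many shapes. As `N ≤ A * M₀ ^ d`, a constant `e` suffices. Both cases are
bounded by `card_witness_le`, and `k + e` is of order `log log N`. -/

/-! ### Counting solutions of acyclic systems of congruences -/

/-- Congruences between coordinates, each of which determines a new coordinate in terms of earlier
ones, are satisfied with the probability that independence suggests. -/
theorem card_filter_congr_mul_prod_le {ι V : Type*} [DecidableEq ι] [Fintype V] [DecidableEq V]
    {R : ℕ} (S : Finset ι) (tgt src : ι → V) (m r : ι → ℕ) (hm : ∀ i ∈ S, m i ∣ R)
    (hinj : Set.InjOn tgt S)
    (hr : ∀ i ∈ S, ∀ j ∈ S, src i = tgt j → r j < r i) :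
    (Finset.univ.filter fun f : V → Fin R =>
      ∀ i ∈ S, (f (tgt i) : ℕ) % m i = f (src i) % m i).card * ∏ i ∈ S, m i
      ≤ R ^ Fintype.card V := by
  -- The target of a condition of largest rank is the source of no condition, so its coordinate can
  -- be varied without affecting the other conditions.
  induction S using Finset.induction_on_max_value r with
  | empty => simp
  | insert a s ha hmax ih =>
    have ih := ih (fun i hi => hm i (Finset.mem_insert_of_mem hi))
      (hinj.mono (by simp))
      (fun i hi j hj => hr i (Finset.mem_insert_of_mem hi) j (Finset.mem_insert_of_mem hj))
    rw [Finset.prod_insert ha, ← mul_assoc]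
    refine le_trans (Nat.mul_le_mul_right _ ?_) ih
    have hma := hm a (Finset.mem_insert_self _ _)
    have hsa : src a ≠ tgt a := fun h =>
      lt_irrefl _ (hr a (Finset.mem_insert_self _ _) a (Finset.mem_insert_self _ _) h)
    have hts : ∀ i ∈ s, tgt i ≠ tgt a := fun i hi h => by
      have := hinj (Finset.mem_coe.2 (Finset.mem_insert_of_mem hi))
        (Finset.mem_coe.2 (Finset.mem_insert_self _ _)) h
      exact ha (this ▸ hi)
    have hss : ∀ i ∈ s, src i ≠ tgt a := fun i hi h => by
      have := hr i (Finset.mem_insert_of_mem hi) a (Finset.mem_insert_self _ _) h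
      exact absurd (hmax i hi) (not_le.2 this)
    have hlt : ∀ (v : Fin R) (u : Fin (m a)), (v : ℕ) / m a * m a + u < R := by
      intro v u
      obtain ⟨q, hq⟩ := hma
      have h1 : (v : ℕ) / m a < q := Nat.div_lt_of_lt_mul (hq ▸ v.2)
      calc (v : ℕ) / m a * m a + u < (v : ℕ) / m a * m a + m a := by omega
        _ = ((v : ℕ) / m a + 1) * m a := by ring
        _ ≤ q * m a := Nat.mul_le_mul_right _ h1
        _ = R := by rw [hq, mul_comm]
    -- The residue of the coordinate `tgt a` is replaced by an arbitrary one. Nothing is lost, as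
    -- the old residue can be read off at `src a`.
    let g : (V → Fin R) × Fin (m a) → V → Fin R := fun x =>
      Function.update x.1 (tgt a) ⟨(x.1 (tgt a) : ℕ) / m a * m a + x.2, hlt _ _⟩
    calc _ = ((Finset.univ.filter fun f : V → Fin R =>
          ∀ i ∈ insert a s, (f (tgt i) : ℕ) % m i = f (src i) % m i) ×ˢ
            (Finset.univ : Finset (Fin (m a)))).card := by simp [Finset.card_product]
      _ ≤ _ := by
        refine Finset.card_le_card_of_injOn g ?_ ?_
        · rintro ⟨f, u⟩ hf
          simp only [Finset.coe_product, Set.mem_prod, Finset.mem_coe, Finset.mem_filter,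
            Finset.mem_univ, true_and, and_true] at hf ⊢
          intro i hi
          simpa [g, Function.update_of_ne (hts i hi), Function.update_of_ne (hss i hi)] using
            hf i (Finset.mem_insert_of_mem hi)
        · rintro ⟨f, u⟩ hf ⟨f', u'⟩ hf' h
          simp only [Finset.coe_product, Set.mem_prod, Finset.mem_coe, Finset.mem_filter,
            Finset.mem_univ, true_and, and_true] at hf hf'
          have hne : ∀ v ≠ tgt a, f v = f' v := fun v hv => by
            simpa [g, Function.update_of_ne hv] using congrFun h v
          have h1 : (f (tgt a) : ℕ) / m a * m a + u = (f' (tgt a) : ℕ) / m a * m a + u' := by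
            simpa [g] using congrArg Fin.val (congrFun h (tgt a))
          have hpos : 0 < m a := lt_of_le_of_lt (Nat.zero_le _) u.2
          have h2 : (u : ℕ) = u' := by
            have := congrArg (· % m a) h1
            simpa [Nat.add_mod, Nat.mod_eq_of_lt u.2, Nat.mod_eq_of_lt u'.2] using this
          have h3 : (f (tgt a) : ℕ) % m a = f' (tgt a) % m a := by
            rw [hf a (Finset.mem_insert_self _ _), hf' a (Finset.mem_insert_self _ _),
              hne _ hsa]
          have h4 : (f (tgt a) : ℕ) = f' (tgt a) := by
            rw [← Nat.div_add_mod' (f (tgt a) : ℕ) (m a),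
              ← Nat.div_add_mod' (f' (tgt a) : ℕ) (m a), h3]
            omega
          refine Prod.ext (funext fun v => ?_) (Fin.ext h2)
          by_cases hv : v = tgt a
          · exact hv ▸ Fin.ext h4
          · exact hne v hv

/-! ### Weighted labellings of trees -/

/-- The functions that take the value `z₀` outside of `W`. -/
def supportedIn {ι L : Type*} [Fintype ι] [DecidableEq ι] [Fintype L] (z₀ : L) (W : Finset ι) :
    Finset (ι → L) :=
  Fintype.piFinset fun t => if t ∈ W then Finset.univ else {z₀}

theorem mem_supportedIn {ι L : Type*} [Fintype ι] [DecidableEq ι] [Fintype L] {z₀ : L}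
    {W : Finset ι} {φ : ι → L} : φ ∈ supportedIn z₀ W ↔ ∀ t ∉ W, φ t = z₀ := by
  classical
  simp only [supportedIn, Fintype.mem_piFinset]
  refine forall_congr' fun t => ?_
  by_cases h : t ∈ W <;> simp [h]

theorem sum_supportedIn_insert {ι L : Type*} [Fintype ι] [DecidableEq ι] [Fintype L] {z₀ : L}
    {W : Finset ι} {a : ι} (ha : a ∉ W) (F : (ι → L) → ℝ) :
    ∑ φ ∈ supportedIn z₀ (insert a W), F φ =
      ∑ φ ∈ supportedIn z₀ W, ∑ z, F (Function.update φ a z) := by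
  rw [← Finset.sum_product']
  refine Finset.sum_bij' (fun φ _ => (Function.update φ a z₀, φ a))
    (fun x _ => Function.update x.1 a x.2) ?_ ?_ ?_ ?_ ?_
  · intro φ hφ
    simp only [Finset.mem_product, Finset.mem_univ, and_true, mem_supportedIn] at hφ ⊢
    intro t ht
    by_cases h : t = a
    · simp [h]
    · rw [Function.update_of_ne h]
      exact hφ t (by simp [h, ht])
  · rintro ⟨φ, z⟩ hφ
    simp only [Finset.mem_product, Finset.mem_univ, and_true, mem_supportedIn] at hφ ⊢
    intro t ht
    rw [Finset.mem_insert, not_or] at ht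
    rw [Function.update_of_ne ht.1]
    exact hφ t ht.2
  · intro φ _
    simp
  · rintro ⟨φ, z⟩ hφ
    simp only [Finset.mem_product, Finset.mem_univ, and_true, mem_supportedIn] at hφ
    have : Function.update φ a z₀ = φ := by
      rw [← hφ a ha]; simp
    simp [this]
  · intro φ _
    simp

/-- A weighted count of the labellings of a tree with root `ρ`, other nodes `V` and parents `p`. -/
theorem sum_prod_kernel_le {ι L : Type*} [Fintype ι] [DecidableEq ι] [Fintype L]
    (z₀ : L) (κ : L → L → ℝ) (hκ0 : ∀ x y, 0 ≤ κ x y) (hκ : ∀ x, ∑ y, κ x y ≤ 1 / 2)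
    (lvl : ι → ℕ) (p : ι → ι) (ρ : ι) (V : Finset ι) (hρ : ρ ∉ V)
    (hp : ∀ t ∈ V, p t ∈ insert ρ V ∧ lvl (p t) < lvl t) :
    ∑ φ ∈ supportedIn z₀ (insert ρ V), ∏ t ∈ V, κ (φ (p t)) (φ t) ≤
      Fintype.card L * (1 / 2) ^ V.card := by
  -- A node of largest level is a leaf; summing over its label first costs a factor `1 / 2`.
  induction V using Finset.induction_on_max_value lvl with
  | empty =>
    rw [sum_supportedIn_insert (by simp)]
    have : supportedIn z₀ (∅ : Finset ι) = {fun _ => z₀} := by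
      ext φ; simp [mem_supportedIn, funext_iff]
    simp [this]
  | insert a s ha hmax ih =>
    have haρ : a ≠ ρ := fun h => hρ (h ▸ Finset.mem_insert_self _ _)
    have hps : ∀ t ∈ s, p t ≠ a := fun t ht h => by
      have := (hp t (Finset.mem_insert_of_mem ht)).2
      rw [h] at this
      exact absurd (hmax t ht) (not_le.2 this)
    have hpa : p a ≠ a := fun h => by
      have := (hp a (Finset.mem_insert_self _ _)).2
      rw [h] at this
      exact lt_irrefl _ this
    have ih := ih (fun h => hρ (Finset.mem_insert_of_mem h)) fun t ht => by
      have h1 := hp t (Finset.mem_insert_of_mem ht)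
      refine ⟨?_, h1.2⟩
      have h2 := h1.1
      simp only [Finset.mem_insert] at h2 ⊢
      rcases h2 with h2 | h2 | h2
      · exact Or.inl h2
      · exact absurd h2 (hps t ht)
      · exact Or.inr h2
    rw [Finset.insert_comm, sum_supportedIn_insert (by simp [haρ, ha]),
      Finset.card_insert_of_notMem ha, pow_succ, ← mul_assoc]
    refine le_trans ?_ (mul_le_mul_of_nonneg_right ih (by norm_num))
    rw [Finset.sum_mul]
    refine Finset.sum_le_sum fun φ _ => ?_
    have : ∀ z, ∏ t ∈ insert a s, κ (Function.update φ a z (p t)) (Function.update φ a z t) =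
        (∏ t ∈ s, κ (φ (p t)) (φ t)) * κ (φ (p a)) z := by
      intro z
      rw [Finset.prod_insert ha, mul_comm, Function.update_of_ne hpa, Function.update_self]
      congr 1
      refine Finset.prod_congr rfl fun t ht => ?_
      rw [Function.update_of_ne (hps t ht), Function.update_of_ne (ne_of_mem_of_not_mem ht ha)]
    simp_rw [this]
    rw [← Finset.mul_sum]
    exact mul_le_mul_of_nonneg_left (hκ _) (Finset.prod_nonneg fun _ _ => hκ0 _ _)

/-! ### First moment bound for witness trees -/

/-- The ball `z.1`, placed by its hash value `z.2`, is older than the ball `y.1` and lies, when `y.1`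
is inserted, in the bin that was not chosen for `y.1`. -/
def Hit {N R : ℕ} (m : Fin N → ℕ) (f : Fin N × Fin 2 → Fin R) (y z : Fin N × Fin 2) : Prop :=
  z.1 < y.1 ∧ (f z : ℕ) % m y.1 = f (y.1, y.2 + 1) % m y.1

set_option maxHeartbeats 800000 in
/-- A first moment bound for trees of hits in which the bins in `Q` are hit a second time. -/
theorem card_witness_le {N R M₀ : ℕ} (hM₀ : 0 < M₀) (m : Fin N → ℕ) (hmR : ∀ y, m y ∣ R)
    (hm4 : ∀ y : Fin N, 4 * (y : ℕ) ≤ m y) (hmM : ∀ y, M₀ ≤ m y)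
    {ι : Type*} [Fintype ι] [DecidableEq ι]
    (lvl : ι → ℕ) (p : ι → ι) (ρ : ι) (V : Finset ι) (hρ : ρ ∉ V)
    (hp : ∀ t ∈ V, p t ∈ insert ρ V ∧ lvl (p t) < lvl t)
    (Q : Finset ι) (hQ : Q ⊆ insert ρ V) (b : ι → ι) (hb : ∀ q ∈ Q, b q ∈ V) (σ : ι → ℕ)
    (hσ : ∀ q ∈ Q, p (b q) ∈ Q → σ (p (b q)) < σ q)
    (E : Finset (Fin N × Fin 2 → Fin R))
    (hE : ∀ f ∈ E, ∃ φ : ι → Fin N × Fin 2,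
      Set.InjOn (fun t => (φ t).1) (insert ρ V : Finset ι) ∧
      (∀ t ∈ V, Hit m f (φ (p t)) (φ t)) ∧ ∀ q ∈ Q, Hit m f (φ q) (φ (b q))) :
    (E.card : ℝ) ≤
      (R : ℝ) ^ (2 * N) * (2 * N * (1 / 2) ^ V.card * (1 / (M₀ : ℝ)) ^ Q.card) := by
  classical
  rcases Nat.eq_zero_or_pos N with hN | hN
  · have : E = ∅ := by
      refine Finset.eq_empty_of_forall_notMem fun f hf => ?_
      obtain ⟨φ, -⟩ := hE f hf
      exact absurd (φ ρ).1.2 (by omega)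
    subst this
    simp only [Finset.card_empty, Nat.cast_zero]
    positivity
  let z₀ : Fin N × Fin 2 := (⟨0, hN⟩, 0)
  have hmpos : ∀ y, (0 : ℝ) < m y := fun y => by
    exact_mod_cast lt_of_lt_of_le hM₀ (hmM y)
  -- The probability that a given older ball and hash value hit the rejected bin of `y`. Row sums
  -- are at most `1 / 2`: there are `2 * y.1` candidates and `m y.1 ≥ 4 * y.1`.
  let κ : Fin N × Fin 2 → Fin N × Fin 2 → ℝ := fun y z => if z.1 < y.1 then 1 / (m y.1 : ℝ) else 0
  have hκ0 : ∀ x y, 0 ≤ κ x y := fun x y => by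
    have := hmpos x.1
    simp only [κ]; split_ifs <;> positivity
  have hκ : ∀ x, ∑ y, κ x y ≤ 1 / 2 := by
    intro x
    rw [Fintype.sum_prod_type]
    simp only [κ, Fin.sum_univ_two, ← two_mul, ← Finset.mul_sum]
    rw [Finset.sum_ite, Finset.sum_const_zero, add_zero, Finset.sum_const,
      nsmul_eq_mul]
    have h1 : (Finset.univ.filter fun z : Fin N => z < x.1).card = x.1 := by
      rw [show (Finset.univ.filter fun z : Fin N => z < x.1) = Finset.Iio x.1 by ext; simp]
      simp
    rw [h1]
    have h2 : (4 : ℝ) * ((x.1 : ℕ) : ℝ) ≤ m x.1 := by exact_mod_cast hm4 x.1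
    have h3 : ((x.1 : ℕ) : ℝ) * (1 / (m x.1 : ℝ)) ≤ 1 / 4 := by
      rw [mul_one_div, div_le_iff₀ (hmpos _)]; linarith
    linarith
  let G : (ι → Fin N × Fin 2) → Finset (Fin N × Fin 2 → Fin R) := fun φ =>
    Finset.univ.filter fun f => Set.InjOn (fun t => (φ t).1) (insert ρ V : Finset ι) ∧
      (∀ t ∈ V, Hit m f (φ (p t)) (φ t)) ∧ ∀ q ∈ Q, Hit m f (φ q) (φ (b q))
  have hsub : E ⊆ (supportedIn z₀ (insert ρ V)).biUnion G := by
    intro f hf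
    obtain ⟨φ, h1, h2, h3⟩ := hE f hf
    have hφ : ∀ t ∈ insert ρ V, (if t ∈ insert ρ V then φ t else z₀) = φ t := fun t ht => if_pos ht
    -- Labels outside the tree are irrelevant; they are reset to `z₀` so that the sum does not count
    -- them.
    refine Finset.mem_biUnion.2 ⟨fun t => if t ∈ insert ρ V then φ t else z₀, ?_, ?_⟩
    · exact mem_supportedIn.2 fun t ht => if_neg ht
    · simp only [G, Finset.mem_filter, Finset.mem_univ, true_and]
      refine ⟨fun s hs t ht h => h1 hs ht ?_, fun t ht => ?_, fun q hq => ?_⟩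
      · simp only [] at h
        rwa [hφ s (by simpa using hs), hφ t (by simpa using ht)] at h
      · rw [hφ _ (hp t ht).1, hφ _ (Finset.mem_insert_of_mem ht)]
        exact h2 t ht
      · rw [hφ _ (hQ hq), hφ _ (Finset.mem_insert_of_mem (hb q hq))]
        exact h3 q hq
  have hG : ∀ φ, ((G φ).card : ℝ) ≤
      (R : ℝ) ^ (2 * N) * (1 / (M₀ : ℝ)) ^ Q.card * ∏ t ∈ V, κ (φ (p t)) (φ t) := by
    intro φ
    -- Distinctness and age order of the balls depend on `φ` alone, so one member of `G φ` provides
    -- them.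
    rcases (G φ).eq_empty_or_nonempty with h0 | ⟨f₀, hf₀⟩
    · rw [h0]
      have := Finset.prod_nonneg fun t (_ : t ∈ V) => hκ0 (φ (p t)) (φ t)
      simp only [Finset.card_empty, Nat.cast_zero]
      positivity
    simp only [G, Finset.mem_filter, Finset.mem_univ, true_and] at hf₀
    obtain ⟨hinj, hV, -⟩ := hf₀
    have hinj' : ∀ s ∈ insert ρ V, ∀ t ∈ insert ρ V, (φ s).1 = (φ t).1 → s = t :=
      fun s hs t ht h => hinj (by simpa using hs) (by simpa using ht) h
    have hprod : ∏ t ∈ V, κ (φ (p t)) (φ t) = ∏ t ∈ V, 1 / (m (φ (p t)).1 : ℝ) :=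
      Finset.prod_congr rfl fun t ht => by simp [κ, (hV t ht).1]
    -- A tree edge determines the used hash value of the child; a second hit determines the rejected
    -- hash value of the node in `Q`. As the balls are distinct, so are these coordinates.
    let tgt : ι ⊕ ι → Fin N × Fin 2 := Sum.elim φ fun q => ((φ q).1, (φ q).2 + 1)
    let src : ι ⊕ ι → Fin N × Fin 2 :=
      Sum.elim (fun t => ((φ (p t)).1, (φ (p t)).2 + 1)) fun q => φ (b q)
    let md : ι ⊕ ι → ℕ := Sum.elim (fun t => m (φ (p t)).1) fun q => m (φ q).1
    -- An edge below a node of `Q` reads the rejected hash value of that node and so ranks just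
    -- above its second hit. By `hσ`, the second hit at `q` ranks above the edge into `b q`.
    let r : ι ⊕ ι → ℕ :=
      Sum.elim (fun t => if p t ∈ Q then 2 * σ (p t) + 2 else 0) fun q => 2 * σ q + 1
    have hne : ∀ j : Fin 2, j + 1 ≠ j := by decide
    have key := card_filter_congr_mul_prod_le (R := R) (V.disjSum Q) tgt src md r
      (by rintro (t | q) _ <;> exact hmR _)
      (by
        rintro (s | s) hs (t | t) ht h <;>
          simp only [Finset.mem_coe, Finset.inl_mem_disjSum, Finset.inr_mem_disjSum] at hs ht <;>
          simp only [tgt, Sum.elim_inl, Sum.elim_inr] at h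
        · rw [hinj' s (Finset.mem_insert_of_mem hs) t (Finset.mem_insert_of_mem ht)
            (Prod.ext_iff.1 h).1]
        · have := hinj' s (Finset.mem_insert_of_mem hs) t (hQ ht) (Prod.ext_iff.1 h).1
          subst this
          exact absurd (Prod.ext_iff.1 h).2.symm (hne _)
        · have := hinj' s (hQ hs) t (Finset.mem_insert_of_mem ht) (Prod.ext_iff.1 h).1
          subst this
          exact absurd (Prod.ext_iff.1 h).2 (hne _)
        · rw [hinj' s (hQ hs) t (hQ ht) (Prod.ext_iff.1 h).1])
      (by
        rintro (s | s) hs (t | t) ht h <;>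
          simp only [Finset.inl_mem_disjSum, Finset.inr_mem_disjSum] at hs ht <;>
          simp only [tgt, src, Sum.elim_inl, Sum.elim_inr] at h
        · have := hinj' (p s) (hp s hs).1 t (Finset.mem_insert_of_mem ht) (Prod.ext_iff.1 h).1
          rw [this] at h
          exact absurd (Prod.ext_iff.1 h).2 (hne _)
        · have := hinj' (p s) (hp s hs).1 t (hQ ht) (Prod.ext_iff.1 h).1
          simp [r, this, ht]
        · have := hinj' (b s) (Finset.mem_insert_of_mem (hb s hs)) t (Finset.mem_insert_of_mem ht)
            (Prod.ext_iff.1 h).1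
          subst this
          simp only [r, Sum.elim_inl, Sum.elim_inr]
          split_ifs with h'
          · have := hσ s hs h'
            omega
          · omega
        · have := hinj' (b s) (Finset.mem_insert_of_mem (hb s hs)) t (hQ ht) (Prod.ext_iff.1 h).1
          subst this
          exact absurd (Prod.ext_iff.1 h).2.symm (hne _))
    have key2 : (G φ).card * ∏ i ∈ V.disjSum Q, md i ≤ R ^ Fintype.card (Fin N × Fin 2) := by
      refine (Nat.mul_le_mul_right _ (Finset.card_le_card fun f hf => ?_)).trans key
      simp only [G, Finset.mem_filter, Finset.mem_univ, true_and] at hf ⊢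
      rintro (t | q) hi <;>
        simp only [Finset.inl_mem_disjSum, Finset.inr_mem_disjSum] at hi
      · simpa only [tgt, src, md, Sum.elim_inl] using (hf.2.1 t hi).2
      · simpa only [tgt, src, md, Sum.elim_inr] using (hf.2.2 q hi).2.symm
    rw [Finset.prod_disjSum] at key2
    simp only [md, Sum.elim_inl, Sum.elim_inr] at key2
    rw [Fintype.card_prod, Fintype.card_fin, Fintype.card_fin,
      mul_comm N 2] at key2
    have key3 : ((G φ).card : ℝ) * ((∏ t ∈ V, (m (φ (p t)).1 : ℝ)) * (M₀ : ℝ) ^ Q.card) ≤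
        (R : ℝ) ^ (2 * N) := by
      have h1 : ((G φ).card : ℝ) * ((∏ t ∈ V, (m (φ (p t)).1 : ℝ)) * ∏ q ∈ Q, (m (φ q).1 : ℝ)) ≤
          (R : ℝ) ^ (2 * N) := by exact_mod_cast key2
      refine le_trans ?_ h1
      have h2 : (M₀ : ℝ) ^ Q.card ≤ ∏ q ∈ Q, (m (φ q).1 : ℝ) := by
        rw [← Finset.prod_const]
        exact Finset.prod_le_prod (fun _ _ => by positivity)
          (fun q _ => by exact_mod_cast hmM _)
      have h3 : (0 : ℝ) ≤ ∏ t ∈ V, (m (φ (p t)).1 : ℝ) := by positivity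
      gcongr
    have hPpos : (0 : ℝ) < ∏ t ∈ V, (m (φ (p t)).1 : ℝ) := Finset.prod_pos fun _ _ => hmpos _
    have hMpos : (0 : ℝ) < (M₀ : ℝ) ^ Q.card := by positivity
    rw [hprod, Finset.prod_div_distrib, Finset.prod_const_one, one_div_pow, mul_assoc,
      one_div_mul_one_div, mul_one_div, le_div_iff₀ (by positivity), mul_comm ((M₀ : ℝ) ^ _)]
    exact key3
  have hK := sum_prod_kernel_le z₀ κ hκ0 hκ lvl p ρ V hρ hp
  calc (E.card : ℝ) ≤ ((supportedIn z₀ (insert ρ V)).biUnion G).card := by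
        exact_mod_cast Finset.card_le_card hsub
    _ ≤ ∑ φ ∈ supportedIn z₀ (insert ρ V), ((G φ).card : ℝ) := by
        exact_mod_cast Finset.card_biUnion_le
    _ ≤ ∑ φ ∈ supportedIn z₀ (insert ρ V),
        (R : ℝ) ^ (2 * N) * (1 / (M₀ : ℝ)) ^ Q.card * ∏ t ∈ V, κ (φ (p t)) (φ t) :=
        Finset.sum_le_sum fun φ _ => hG φ
    _ ≤ (R : ℝ) ^ (2 * N) * (1 / (M₀ : ℝ)) ^ Q.card *
        (Fintype.card (Fin N × Fin 2) * (1 / 2) ^ V.card) := by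
        rw [← Finset.mul_sum]
        exact mul_le_mul_of_nonneg_left hK (by positivity)
    _ = _ := by
        simp only [Fintype.card_prod, Fintype.card_fin]
        push_cast
        ring

/-! ### Bins, heights and hits in the process -/

/-- The number of bins when a ball is inserted to which `n` balls are already present. -/
noncomputable def binsAt (M₀ n : ℕ) : ℕ := M₀ * 2 ^ sInf {j | 4 * n ≤ M₀ * 2 ^ j}

theorem le_binsAt (M₀ n : ℕ) : M₀ ≤ binsAt M₀ n := Nat.le_mul_of_pos_right _ (by positivity)

theorem four_mul_le_binsAt {M₀ : ℕ} (hM₀ : 0 < M₀) (n : ℕ) : 4 * n ≤ binsAt M₀ n := by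
  refine Nat.sInf_mem (s := {j | 4 * n ≤ M₀ * 2 ^ j}) ⟨4 * n, ?_⟩
  calc 4 * n ≤ 2 ^ (4 * n) := Nat.lt_two_pow_self.le
    _ ≤ M₀ * 2 ^ (4 * n) := Nat.le_mul_of_pos_left _ hM₀

theorem binsAt_dvd {M₀ n j : ℕ} (h : 4 * n ≤ M₀ * 2 ^ j) : binsAt M₀ n ∣ M₀ * 2 ^ j :=
  Nat.mul_dvd_mul_left _ (pow_dvd_pow _ (Nat.sInf_le h))

theorem binsAt_dvd_binsAt {M₀ : ℕ} (hM₀ : 0 < M₀) {n n' : ℕ} (h : n ≤ n') :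
    binsAt M₀ n ∣ binsAt M₀ n' :=
  binsAt_dvd (le_trans (by omega) (four_mul_le_binsAt hM₀ n'))

theorem eq_binsAt {M₀ n j : ℕ} (h : 4 * n ≤ M₀ * 2 ^ j) (h' : ∀ i < j, M₀ * 2 ^ i < 4 * n) :
    M₀ * 2 ^ j = binsAt M₀ n := by
  have h1 : sInf {j | 4 * n ≤ M₀ * 2 ^ j} = j := by
    refine le_antisymm (Nat.sInf_le h) (not_lt.1 fun hlt => ?_)
    have h2 : 4 * n ≤ M₀ * 2 ^ sInf {j | 4 * n ≤ M₀ * 2 ^ j} :=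
      Nat.sInf_mem (s := {j | 4 * n ≤ M₀ * 2 ^ j}) ⟨j, h⟩
    exact absurd (h' _ hlt) (not_lt.2 h2)
  rw [binsAt, h1]

/-- The number of balls in the bin of ball `y` right after its insertion. -/
noncomputable def height {N : ℕ} (H : Hashes N) (M₀ : ℕ) (c : Fin N → Fin 2) (y : Fin N) : ℕ :=
  load H ⟨binsAt M₀ y, y, c⟩ (binOf H (binsAt M₀ y) y (c y)) + 1

theorem load_congr {N : ℕ} (H : Hashes N) {m n : ℕ} {c c' : Fin N → Fin 2}
    (h : ∀ x : Fin N, (x : ℕ) < n → c x = c' x) (i : ℕ) : load H ⟨m, n, c⟩ i = load H ⟨m, n, c'⟩ i := by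
  unfold load
  congr 1
  ext x
  simp only [Finset.mem_filter, Finset.mem_univ, true_and]
  refine and_congr_right fun hx => ?_
  rw [h x hx]

/-- The choices `c` obey the rule of two choices at all of the first `n` insertions. -/
def IsGreedy {N : ℕ} (H : Hashes N) (M₀ n : ℕ) (c : Fin N → Fin 2) : Prop :=
  ∀ y : Fin N, (y : ℕ) < n → ∀ j, load H ⟨binsAt M₀ y, y, c⟩ (binOf H (binsAt M₀ y) y (c y)) ≤
    load H ⟨binsAt M₀ y, y, c⟩ (binOf H (binsAt M₀ y) y j)

/-- This turns the process into static data: choices that are greedy with respect to the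
deterministic moduli `binsAt`. Tie-breaking survives only in the choices. -/
theorem Occurs.invariant {N M₀ : ℕ} {H : Hashes N} {s : State N} (hs : Occurs M₀ H s) :
    (∃ j, s.bins = M₀ * 2 ^ j ∧ ∀ i < j, M₀ * 2 ^ i < 4 * s.balls) ∧
      (∀ y : Fin N, (y : ℕ) < s.balls → binsAt M₀ y ∣ s.bins) ∧
      IsGreedy H M₀ s.balls s.choice := by
  unfold Occurs at hs
  induction hs with
  | refl =>
    refine ⟨⟨0, by simp [start], by simp⟩, ?_, ?_⟩
    · intro y hy; simp [start] at hy
    · intro y hy; simp [start] at hy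
  | @tail s _ _ hstep ih =>
    obtain ⟨⟨k, hk, hk'⟩, hdvd, hgr⟩ := ih
    cases hstep with
    | double hs =>
      refine ⟨⟨k + 1, ?_, fun i hi => ?_⟩, fun y hy => (hdvd y hy).mul_left _, hgr⟩
      · simp only [hk, pow_succ]; ring
      · rcases Nat.lt_succ_iff_lt_or_eq.1 hi with h | h
        · exact hk' i h
        · rw [h, ← hk]; exact hs
    | insert hs hN j hj =>
      have hb : s.bins = binsAt M₀ s.balls := hk ▸ eq_binsAt (hk ▸ hs) hk'
      refine ⟨⟨k, hk, fun i hi => ?_⟩, fun y hy => ?_, fun y hy j' => ?_⟩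
      · have := hk' i hi
        simp only
        omega
      · rcases Nat.lt_succ_iff_lt_or_eq.1 hy with h | h
        · exact hdvd y h
        · simp only [h, hb, dvd_refl]
      · simp only at hy ⊢
        have hne : ∀ x : Fin N, (x : ℕ) < s.balls → x ≠ ⟨s.balls, hN⟩ := fun x hx h => by
          rw [h] at hx; simp at hx
        have hload : ∀ i, load H ⟨binsAt M₀ y, y, Function.update s.choice ⟨s.balls, hN⟩ j⟩ i =
            load H ⟨binsAt M₀ y, y, s.choice⟩ i := fun i =>
          load_congr H (fun x hx => Function.update_of_ne (hne x (by omega)) _ _) i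
        rw [hload, hload]
        rcases Nat.lt_succ_iff_lt_or_eq.1 hy with h | h
        · rw [Function.update_of_ne (hne y h)]
          exact hgr y h j'
        · obtain rfl : y = ⟨s.balls, hN⟩ := Fin.ext h
          rw [Function.update_self]
          simp only [← hb]
          have := hj j'
          rwa [load_congr H (m := s.bins) (n := s.balls) (c' := s.choice) (fun _ _ => rfl)]

/-- The `i`-th oldest ball of a bin has a height that exceeds `i`. -/
theorem exists_ball_of_height {N M₀ : ℕ} (H : Hashes N) (c : Fin N → Fin 2) (m n b : ℕ)
    (hm : ∀ y : Fin N, (y : ℕ) < n → binsAt M₀ y ∣ m) :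
    ∃ z : Fin (load H ⟨m, n, c⟩ b) → Fin N, Function.Injective z ∧
      ∀ i, (z i : ℕ) < n ∧ binOf H m (z i) (c (z i)) = b ∧ (i : ℕ) < height H M₀ c (z i) := by
  let S := Finset.univ.filter fun x : Fin N => (x : ℕ) < n ∧ binOf H m x (c x) = b
  have hS : S.card = load H ⟨m, n, c⟩ b := rfl
  have hmem : ∀ i, (S.orderEmbOfFin hS i : ℕ) < n ∧
      binOf H m (S.orderEmbOfFin hS i) (c (S.orderEmbOfFin hS i)) = b := fun i => 
    (Finset.mem_filter.1 (S.orderEmbOfFin_mem hS i)).2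
  refine ⟨S.orderEmbOfFin hS, (S.orderEmbOfFin hS).injective,
    fun i => ⟨(hmem i).1, (hmem i).2, Nat.lt_succ_of_le ?_⟩⟩
  set z := S.orderEmbOfFin hS
  calc (i : ℕ) = (Finset.Iio i).card := by simp
    _ = ((Finset.Iio i).map z.toEmbedding).card := by simp
    _ ≤ _ := by
      refine Finset.card_le_card fun x hx => ?_
      obtain ⟨j, hj, rfl⟩ := Finset.mem_map.1 hx
      have hlt : z j < z i := z.lt_iff_lt.2 (Finset.mem_Iio.1 hj)
      refine Finset.mem_filter.2 ⟨Finset.mem_univ _, hlt, ?_⟩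
      -- Bins only split: a congruence modulo `m` descends to the divisor that was the number of
      -- bins when `z i` was inserted.
      have h1 : H (z j) (c (z j)) ≡ H (z i) (c (z i)) [MOD m] :=
        (hmem j).2.trans (hmem i).2.symm
      exact h1.of_dvd (hm _ (hmem i).1)

/-- The bin that was not chosen for a ball of height `h` contained at least `h - 1` balls. -/
theorem exists_hits {N M₀ n : ℕ} (hM₀ : 0 < M₀) (H : Hashes N) (c : Fin N → Fin 2)
    (hc : IsGreedy H M₀ n c) (y : Fin N) (hy : (y : ℕ) < n) :
    ∃ z : ℕ → Fin N, (∀ i j, i + 1 < height H M₀ c y → j + 1 < height H M₀ c y → z i = z j → i = j) ∧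
      ∀ i, i + 1 < height H M₀ c y → z i < y ∧ i < height H M₀ c (z i) ∧
        H (z i) (c (z i)) % binsAt M₀ y = H y (c y + 1) % binsAt M₀ y := by
  obtain ⟨z, hz, h⟩ := exists_ball_of_height H c (binsAt M₀ y) y
    (binOf H (binsAt M₀ y) y (c y + 1)) (fun x hx => binsAt_dvd_binsAt hM₀ hx.le)
  have hlt : ∀ i, i + 1 < height H M₀ c y → i < load H ⟨binsAt M₀ y, y, c⟩
      (binOf H (binsAt M₀ y) y (c y + 1)) := fun i hi =>
    lt_of_lt_of_le (by unfold height at hi; omega) (hc y hy (c y + 1))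
  refine ⟨fun i => if hi : i + 1 < height H M₀ c y then z ⟨i, hlt i hi⟩ else y, ?_, ?_⟩
  · intro i j hi hj hij
    simp only [hi, hj, dif_pos] at hij
    exact congrArg Fin.val (hz hij)
  · intro i hi
    simp only [hi, dif_pos]
    exact ⟨(h ⟨i, hlt i hi⟩).1, (h ⟨i, hlt i hi⟩).2.2, (h ⟨i, hlt i hi⟩).2.1⟩

theorem exists_height_of_fullest {N M₀ : ℕ} {H : Hashes N} {s : State N}
    (hs : Occurs M₀ H s) {l : ℕ} (hl : l < fullest H s) :
    ∃ y : Fin N, (y : ℕ) < s.balls ∧ l < height H M₀ s.choice y := by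
  obtain ⟨b, -, hb⟩ := Finset.lt_sup_iff.1 hl
  obtain ⟨z, -, h⟩ := exists_ball_of_height H s.choice s.bins s.balls b hs.invariant.2.1
  exact ⟨z ⟨l, hb⟩, (h _).1, (h ⟨l, hb⟩).2.2⟩

/-! ### Binomial trees of hits -/

/-- The parent of a node of the binomial tree on the natural numbers: the leading binary digit is
deleted. -/
def parent (t : ℕ) : ℕ := t % 2 ^ (Nat.size t - 1)

theorem size_pos_of_ne_zero {t : ℕ} (ht : t ≠ 0) : 0 < Nat.size t :=
  Nat.size_pos.2 (Nat.pos_of_ne_zero ht)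

theorem two_pow_size_le {t : ℕ} (ht : t ≠ 0) : 2 ^ (Nat.size t - 1) ≤ t :=
  Nat.lt_size.1 (Nat.sub_lt (size_pos_of_ne_zero ht) one_pos)

theorem parent_lt {t : ℕ} (ht : t ≠ 0) : parent t < t :=
  lt_of_lt_of_le (Nat.mod_lt _ (by positivity)) (two_pow_size_le ht)

theorem size_parent_lt {t : ℕ} (ht : t ≠ 0) : Nat.size (parent t) < Nat.size t := by
  have h1 : Nat.size (parent t) ≤ Nat.size t - 1 := Nat.size_le.2 (Nat.mod_lt _ (by positivity))
  have h2 := size_pos_of_ne_zero ht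
  omega

theorem eq_parent_add {t : ℕ} (ht : t ≠ 0) : t = parent t + 2 ^ (Nat.size t - 1) := by
  have h1 := two_pow_size_le ht
  have h2 : t < 2 ^ Nat.size t := Nat.lt_size_self t
  have h3 : 2 ^ Nat.size t = 2 * 2 ^ (Nat.size t - 1) := by
    rw [← pow_succ', Nat.sub_add_cancel (size_pos_of_ne_zero ht)]
  unfold parent
  rw [Nat.mod_eq_sub_mod h1, Nat.mod_eq_of_lt (by omega)]
  omega

/-- The labelling of the binomial tree in which the root is labelled `y` and a node of size `s` gets
the child number `k - s` of the label of its parent. -/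
def unfolding {B : Type*} (ch : B → ℕ → B) (k : ℕ) (y : B) (t : ℕ) : B :=
  if _h : t = 0 then y else ch (unfolding ch k y (parent t)) (k - Nat.size t)
termination_by t
decreasing_by exact parent_lt _h

theorem unfolding_zero {B : Type*} (ch : B → ℕ → B) (k : ℕ) (y : B) : unfolding ch k y 0 = y := by
  rw [unfolding, dif_pos rfl]

theorem unfolding_of_ne {B : Type*} (ch : B → ℕ → B) (k : ℕ) (y : B) {t : ℕ} (ht : t ≠ 0) :
    unfolding ch k y t = ch (unfolding ch k y (parent t)) (k - Nat.size t) := by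
  rw [unfolding, dif_neg ht]

/-- A node of size `s` needs only height above `k - s`, since its children have sizes `s + 1, …, k`
and hence child numbers below `k - s`. -/
theorem height_unfolding {B : Type*} {ch : B → ℕ → B} {ht : B → ℕ}
    (hch : ∀ y i, i + 1 < ht y → i < ht (ch y i)) {k : ℕ} {y : B} (hy : k < ht y) (t : ℕ)
    (htk : t < 2 ^ k) : k - Nat.size t < ht (unfolding ch k y t) := by
  induction t using Nat.strong_induction_on with
  | _ t ih =>
    rcases eq_or_ne t 0 with rfl | h
    · simpa [unfolding_zero] using hy
    · rw [unfolding_of_ne _ _ _ h]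
      have h1 := ih (parent t) (parent_lt h) ((parent_lt h).trans htk)
      have h2 := size_parent_lt h
      have h3 : Nat.size t ≤ k := Nat.size_le.2 htk
      exact hch _ _ (by omega)

theorem index_lt_height_unfolding {B : Type*} {ch : B → ℕ → B} {ht : B → ℕ}
    (hch : ∀ y i, i + 1 < ht y → i < ht (ch y i)) {k : ℕ} {y : B} (hy : k < ht y) {t : ℕ}
    (htk : t < 2 ^ k) (h : t ≠ 0) :
    k - Nat.size t + 1 < ht (unfolding ch k y (parent t)) := by
  have h1 := height_unfolding hch hy (parent t) ((parent_lt h).trans htk)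
  have h2 := size_parent_lt h
  have h3 : Nat.size t ≤ k := Nat.size_le.2 htk
  omega

/-- Siblings are balls of one bin. Thus a repeat never consists of two siblings, which would yield
the same congruence twice. -/
theorem unfolding_injOn_siblings {B : Type*} {ch : B → ℕ → B} {ht : B → ℕ}
    (hch : ∀ y i, i + 1 < ht y → i < ht (ch y i))
    (hinj : ∀ y i j, i + 1 < ht y → j + 1 < ht y → ch y i = ch y j → i = j)
    {k : ℕ} {y : B} (hy : k < ht y) {s t : ℕ} (hsk : s < 2 ^ k) (htk : t < 2 ^ k) (hs : s ≠ 0)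
    (h : t ≠ 0) (hp : parent s = parent t)
    (hst : unfolding ch k y s = unfolding ch k y t) : s = t := by
  rw [unfolding_of_ne _ _ _ hs, unfolding_of_ne _ _ _ h, hp] at hst
  have h1 := hinj _ _ _ (hp ▸ index_lt_height_unfolding hch hy hsk hs)
    (index_lt_height_unfolding hch hy htk h) hst
  have h3 : Nat.size s ≤ k := Nat.size_le.2 hsk
  have h4 : Nat.size t ≤ k := Nat.size_le.2 htk
  have h5 : Nat.size s = Nat.size t := by omega
  rw [eq_parent_add hs, eq_parent_add h, hp, h5]

/-! ### Exploring a forest up to its repeats -/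

/-- The nodes of a forest of `e` trees below a common root that are the common root, the root of one
of the trees, or a node before `a j` in the `j`-th tree, where `j < i`. -/
def seen {e n : ℕ} [NeZero n] (a : Fin e → Fin n) (i : ℕ) : Set (Option (Fin e × Fin n)) :=
  {t | ∀ x, t = some x → x.2 = 0 ∨ ((x.1 : ℕ) < i ∧ x.2 < a x.1)}

theorem none_mem_seen {e n : ℕ} [NeZero n] (a : Fin e → Fin n) (i : ℕ) : none ∈ seen a i :=
  fun _ h => absurd h (by simp)

theorem some_mem_seen {e n : ℕ} [NeZero n] {a : Fin e → Fin n} {i : ℕ} {x : Fin e × Fin n} :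
    some x ∈ seen a i ↔ x.2 = 0 ∨ ((x.1 : ℕ) < i ∧ x.2 < a x.1) :=
  ⟨fun h => h x rfl, fun h y hy => by cases hy; exact h⟩

/-- If no tree of a labelled forest has distinct labels, then the trees can be explored one after
another until, in each of them, a label is found that was seen before. -/
theorem exists_repeats {B : Type*} {e n : ℕ} [NeZero n] (φ : Option (Fin e × Fin n) → B)
    (h0 : ∀ i j, φ (some (i, 0)) = φ (some (j, 0)) → i = j)
    (hnone : ∀ x, φ (some x) ≠ φ none)
    (hrep : ∀ i, ¬ Function.Injective fun x => φ (some (i, x))) (i : ℕ) (hi : i ≤ e) :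
    ∃ (a : Fin e → Fin n) (b : Fin e → Fin e × Fin n), Set.InjOn φ (seen a i) ∧
      ∀ j : Fin e, (j : ℕ) < i → a j ≠ 0 ∧ some (b j) ∈ seen a (j + 1) ∧
        φ (some (b j)) = φ (some (j, a j)) := by
  induction i with
  | zero =>
    refine ⟨fun _ => 0, fun j => (j, 0), ?_, by simp⟩
    rintro (_ | ⟨i, x⟩) hs (_ | ⟨j, y⟩) ht h
    · rfl
    · exact absurd h.symm (hnone _)
    · exact absurd h (hnone _)
    · rw [some_mem_seen] at hs ht
      simp only [Nat.not_lt_zero, false_and, or_false] at hs ht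
      subst hs ht
      rw [h0 i j h]
  | succ i ih =>
    obtain ⟨a, b, hinj, hab⟩ := ih (by omega)
    let I : Fin e := ⟨i, by omega⟩
    -- The non-root nodes of the new tree whose label occurred before; the least of them becomes the
    -- cut `a I`.
    let bad : Set (Fin n) := {x | x ≠ 0 ∧ ∃ t : Option (Fin e × Fin n),
      (t ∈ seen a i ∨ ∃ y < x, t = some (I, y)) ∧ φ t = φ (some (I, x))}
    have hbad : bad.Nonempty := by
      have h1 := hrep I
      simp only [Function.Injective, not_forall] at h1
      obtain ⟨x, y, hxy, hne⟩ := h1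
      rcases lt_or_gt_of_ne hne with h | h
      · exact ⟨y, (lt_of_le_of_lt (Fin.zero_le _) h).ne', some (I, x), Or.inr ⟨x, h, rfl⟩, hxy⟩
      · exact ⟨x, (lt_of_le_of_lt (Fin.zero_le _) h).ne', some (I, y), Or.inr ⟨y, h, rfl⟩, hxy.symm⟩
    obtain ⟨x, ⟨hx0, t, ht, htx⟩, hmin⟩ := wellFounded_lt.has_min bad hbad
    obtain ⟨b', rfl⟩ : ∃ b', t = some b' := by
      rcases t with _ | b'
      · exact absurd htx.symm (hnone _)
      · exact ⟨b', rfl⟩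
    have hseen : ∀ t, t ∈ seen (Function.update a I x) (i + 1) ↔
        t ∈ seen a i ∨ ∃ y < x, t = some (I, y) := by
      rintro (_ | ⟨j, y⟩)
      · simp [none_mem_seen]
      · simp only [some_mem_seen, Option.some.injEq, Prod.mk.injEq]
        rcases eq_or_ne j I with rfl | hj
        · simp only [Function.update_self, I, Nat.lt_succ_self, true_and, lt_irrefl, false_and,
            or_false, exists_eq_right']
        · have hj' : (j : ℕ) ≠ i := fun h => hj (Fin.ext h)
          simp only [Function.update_of_ne hj, hj, false_and, and_false, exists_false, or_false]
          rw [Nat.lt_succ_iff, le_iff_lt_or_eq]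
          simp [hj']
    have hseen' : ∀ j : ℕ, j < i → seen (Function.update a I x) (j + 1) = seen a (j + 1) := by
      intro j hj
      ext (_ | ⟨l, y⟩)
      · simp [none_mem_seen]
      · simp only [some_mem_seen]
        refine or_congr_right (and_congr_right fun hl => ?_)
        rw [Function.update_of_ne]
        rintro rfl
        simp only [I] at hl
        omega
    -- Below the cut, only the root of the tree can share its label with such a `t`, and all tree
    -- roots count as seen from the start.
    have hnot : ∀ y < x, ∀ t, (t ∈ seen a i ∨ ∃ y' < y, t = some (I, y')) →
        φ t = φ (some (I, y)) → some (I, y) ∈ seen a i := by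
      intro y hy t ht h
      by_cases hy0 : y = 0
      · exact some_mem_seen.2 (Or.inl hy0)
      · exact absurd hy (hmin y ⟨hy0, t, ht, h⟩)
    refine ⟨Function.update a I x, Function.update b I b', ?_, fun j hj => ?_⟩
    · intro s hs t ht h
      rw [hseen] at hs ht
      have hmix : ∀ s ∈ seen a i, ∀ y < x, φ s = φ (some (I, y)) → s = some (I, y) :=
        fun s hs y hy h => hinj hs (hnot y hy s (Or.inl hs) h) h
      rcases hs with hs | ⟨y, hy, rfl⟩ <;> rcases ht with ht | ⟨y', hy', rfl⟩
      · exact hinj hs ht h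
      · exact hmix s hs y' hy' h
      · exact (hmix t ht y hy h.symm).symm
      · rcases lt_trichotomy y y' with hlt | rfl | hlt
        · exact hmix _ (hnot y hy _ (Or.inl (hnot y' hy' _ (Or.inr ⟨y, hlt, rfl⟩) h)) h.symm) _ hy' h
        · rfl
        · exact (hmix _ (hnot y' hy' _ (Or.inl (hnot y hy _ (Or.inr ⟨y', hlt, rfl⟩) h.symm)) h)
            _ hy h.symm).symm
    · rcases eq_or_ne j I with rfl | hjI
      · simp only [Function.update_self]
        exact ⟨hx0, (hseen _).2 ht, htx⟩
      · have hj' : (j : ℕ) ≠ i := fun h => hjI (Fin.ext h)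
        rw [Function.update_of_ne hjI, Function.update_of_ne hjI, hseen' j (by omega)]
        exact hab j (by omega)

theorem unfolding_le {B : Type*} [PartialOrder B] {ch : B → ℕ → B} {ht : B → ℕ}
    (hch : ∀ y i, i + 1 < ht y → i < ht (ch y i)) (hlt : ∀ y i, i + 1 < ht y → ch y i < y)
    {k : ℕ} {y : B} (hy : k < ht y) (t : ℕ) (htk : t < 2 ^ k) : unfolding ch k y t ≤ y := by
  induction t using Nat.strong_induction_on with
  | _ t ih =>
    rcases eq_or_ne t 0 with rfl | h
    · rw [unfolding_zero]
    · refine le_trans ?_ (ih (parent t) (parent_lt h) ((parent_lt h).trans htk))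
      rw [unfolding_of_ne _ _ _ h]
      exact (hlt _ _ (index_lt_height_unfolding hch hy htk h)).le

/-! ### Witness events and their size -/

/-- The parent of a node of the binomial tree on `Fin n`. -/
def finParent {n : ℕ} (t : Fin n) : Fin n :=
  ⟨parent t, lt_of_le_of_lt (Nat.mod_le _ _) t.2⟩

theorem finParent_lt {n : ℕ} [NeZero n] {t : Fin n} (ht : t ≠ 0) : finParent t < t :=
  parent_lt fun h => ht (Fin.ext (by simpa using h))

/-- The parent of a node in `e` copies of a binomial tree below a common root. -/
def forestParent {e n : ℕ} [NeZero n] : Option (Fin e × Fin n) → Option (Fin e × Fin n)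
  | none => none
  | some x => if x.2 = 0 then none else some (x.1, finParent x.2)

/-- The depth-first position of a node within its tree. -/
def forestLevel {e n : ℕ} : Option (Fin e × Fin n) → ℕ
  | none => 0
  | some x => x.2 + 1

theorem forestLevel_parent_lt {e n : ℕ} [NeZero n] {t : Option (Fin e × Fin n)} (ht : t ≠ none) :
    forestLevel (forestParent t) < forestLevel t := by
  rcases t with _ | ⟨i, x⟩
  · exact absurd rfl ht
  · by_cases hx : x = 0
    · simp [forestParent, forestLevel, hx]
    · simpa [forestParent, forestLevel, hx] using finParent_lt hx

theorem forestParent_mem_seen {e n : ℕ} [NeZero n] {a : Fin e → Fin n} {i : ℕ}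
    {t : Option (Fin e × Fin n)} (ht : t ∈ seen a i) : forestParent t ∈ seen a i := by
  rcases t with _ | ⟨j, x⟩
  · exact ht
  · by_cases hx : x = 0
    · simp [forestParent, hx, none_mem_seen]
    · rw [some_mem_seen] at ht
      simp only [forestParent, hx, if_false, some_mem_seen]
      exact Or.inr ((ht.resolve_left hx).imp_right fun h => (finParent_lt hx).trans h)

open Classical in
/-- The hash values that admit a binomial tree of hits among distinct balls. -/
noncomputable def treeEvent {N R : ℕ} (m : Fin N → ℕ) (n : ℕ) [NeZero n] :
    Finset (Fin N × Fin 2 → Fin R) :=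
  Finset.univ.filter fun f => ∃ φ : Fin n → Fin N × Fin 2,
    Function.Injective (fun t => (φ t).1) ∧ ∀ t ≠ 0, Hit m f (φ (finParent t)) (φ t)

open Classical in
/-- The hash values that admit a forest of hits, cut off before the nodes `a i`, such that the ball
at the `i`-th of these nodes is also the ball at the node `b i`. -/
noncomputable def repeatEvent {N R e n : ℕ} [NeZero n] (m : Fin N → ℕ) (a : Fin e → Fin n)
    (b : Fin e → Fin e × Fin n) : Finset (Fin N × Fin 2 → Fin R) :=
  Finset.univ.filter fun f =>
    (∀ i, a i ≠ 0 ∧ some (b i) ∈ seen a (i + 1) ∧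
      ((b i).1 = i → (b i).2 ≠ 0 → finParent (b i).2 ≠ finParent (a i))) ∧
    ∃ φ : Option (Fin e × Fin n) → Fin N × Fin 2,
      Set.InjOn (fun t => (φ t).1) (seen a e) ∧
      (∀ t ∈ seen a e, t ≠ none → Hit m f (φ (forestParent t)) (φ t)) ∧
      ∀ i, Hit m f (φ (some (i, finParent (a i)))) (φ (some (b i)))

theorem card_treeEvent_le {N R M₀ n : ℕ} [NeZero n] (hM₀ : 0 < M₀) (m : Fin N → ℕ)
    (hmR : ∀ y, m y ∣ R) (hm4 : ∀ y : Fin N, 4 * (y : ℕ) ≤ m y) (hmM : ∀ y, M₀ ≤ m y) :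
    ((treeEvent m n : Finset (Fin N × Fin 2 → Fin R)).card : ℝ) ≤
      (R : ℝ) ^ (2 * N) * (2 * N * (1 / 2) ^ (n - 1)) := by
  have hV : ∀ t : Fin n, t ∈ insert 0 ((Finset.univ : Finset (Fin n)).erase 0) := fun t => by
    by_cases h : t = 0 <;> simp [h]
  have := card_witness_le hM₀ m hmR hm4 hmM (fun t : Fin n => (t : ℕ)) finParent 0
    (Finset.univ.erase 0) (by simp)
    (fun t ht => ⟨hV _, finParent_lt (Finset.ne_of_mem_erase ht)⟩) ∅ (by simp) id (by simp)
    (fun _ => 0) (by simp) (treeEvent m n : Finset (Fin N × Fin 2 → Fin R)) (by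
      intro f hf
      classical
      obtain ⟨φ, h1, h2⟩ := (Finset.mem_filter.1 hf).2
      exact ⟨φ, h1.injOn, fun t ht => h2 t (Finset.ne_of_mem_erase ht), by simp⟩)
  simpa [Finset.card_erase_of_mem] using this

/-- The cuts may leave few nodes, so the factor `(1 / 2) ^ V.card` is dropped; the gain comes from
one second hit per tree, at the parent of the cut. -/
theorem card_repeatEvent_le {N R M₀ e n : ℕ} [NeZero n] (hM₀ : 0 < M₀) (m : Fin N → ℕ)
    (hmR : ∀ y, m y ∣ R) (hm4 : ∀ y : Fin N, 4 * (y : ℕ) ≤ m y) (hmM : ∀ y, M₀ ≤ m y)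
    (a : Fin e → Fin n) (b : Fin e → Fin e × Fin n) :
    ((repeatEvent m a b : Finset (Fin N × Fin 2 → Fin R)).card : ℝ) ≤
      (R : ℝ) ^ (2 * N) * (2 * N * (1 / (M₀ : ℝ)) ^ e) := by
  classical
  by_cases hab : ∀ i, a i ≠ 0 ∧ some (b i) ∈ seen a (i + 1) ∧
      ((b i).1 = i → (b i).2 ≠ 0 → finParent (b i).2 ≠ finParent (a i))
  swap
  · have : (repeatEvent m a b : Finset (Fin N × Fin 2 → Fin R)) = ∅ :=
      Finset.filter_eq_empty_iff.2 fun f _ h => hab h.1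
    rw [this, Finset.card_empty, Nat.cast_zero]
    positivity
  let V : Finset (Option (Fin e × Fin n)) := (Finset.univ.filter (· ∈ seen a e)).erase none
  have hV : ∀ t, t ∈ insert none V ↔ t ∈ seen a e := fun t => by
    by_cases h : t = none
    · simp [h, none_mem_seen]
    · simp [V, h]
  let q : Fin e → Option (Fin e × Fin n) := fun i => some (i, finParent (a i))
  have hq : Function.Injective q := fun i j h => by
    simpa using congrArg Prod.fst (Option.some.inj h)
  let Q : Finset (Option (Fin e × Fin n)) := Finset.univ.image q
  have hQ : ∀ t ∈ Q, ∃ i, t = q i := fun t ht => by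
    obtain ⟨i, -, rfl⟩ := Finset.mem_image.1 ht
    exact ⟨i, rfl⟩
  let b' : Option (Fin e × Fin n) → Option (Fin e × Fin n) := fun t => t.map fun x => b x.1
  let σ : Option (Fin e × Fin n) → ℕ := fun t => t.elim 0 fun x => x.1
  have hseen : ∀ i, some (b i) ∈ seen a e := fun i => by
    have := (hab i).2.1
    rw [some_mem_seen] at this ⊢
    exact this.imp_right fun h => ⟨(b i).1.2, h.2⟩
  have key := card_witness_le hM₀ m hmR hm4 hmM forestLevel forestParent none V (by simp [V])
    (fun t ht => ⟨(hV _).2 (forestParent_mem_seen ((hV t).1 (Finset.mem_insert_of_mem ht))),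
      forestLevel_parent_lt (Finset.ne_of_mem_erase ht)⟩) Q
    (by
      intro t ht
      obtain ⟨i, rfl⟩ := hQ t ht
      exact (hV _).2 (some_mem_seen.2 (Or.inr ⟨i.2, finParent_lt (hab i).1⟩)))
    b'
    (by
      intro t ht
      obtain ⟨i, rfl⟩ := hQ t ht
      exact Finset.mem_erase.2 ⟨by simp [b', q], by simpa [b', q] using hseen i⟩)
    σ
    (by
      intro t ht h
      obtain ⟨i, rfl⟩ := hQ t ht
      obtain ⟨j, hj⟩ := hQ _ h
      have h1 : b' (q i) = some (b i) := rfl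
      rw [hj]
      rw [h1] at hj
      by_cases h0 : (b i).2 = 0
      · simp [forestParent, h0, q] at hj
      · simp only [forestParent, h0, if_false, q, Option.some.injEq, Prod.mk.injEq] at hj
        have h2 := ((some_mem_seen.1 (hab i).2.1).resolve_left h0).1
        -- If `b i` were a child of the parent of `a i`, the second hit would repeat a tree edge.
        -- With that excluded, the parent of `b i` can lie in `Q` only through an earlier tree.
        have h3 : j ≠ i := fun h => (hab i).2.2 (hj.1.trans h) h0 (by rw [hj.2, h])
        have h4 : (j : ℕ) ≠ i := fun h => h3 (Fin.ext h)
        rw [hj.1] at h2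
        simp only [σ, q, Option.elim_some]
        omega)
    (repeatEvent m a b : Finset (Fin N × Fin 2 → Fin R))
    (by
      intro f hf
      obtain ⟨-, φ, h1, h2, h3⟩ := (Finset.mem_filter.1 hf).2
      refine ⟨φ, h1.mono fun t ht => (hV t).1 (Finset.mem_coe.1 ht), fun t ht => h2 t
        ((hV t).1 (Finset.mem_insert_of_mem ht)) (Finset.ne_of_mem_erase ht), fun t ht => ?_⟩
      obtain ⟨i, rfl⟩ := hQ t ht
      exact h3 i)
  have hQcard : Q.card = e := by
    rw [Finset.card_image_of_injective _ hq, Finset.card_univ, Fintype.card_fin]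
  rw [hQcard] at key
  refine key.trans ?_
  have : ((1 : ℝ) / 2) ^ V.card ≤ 1 := pow_le_one₀ (by norm_num) (by norm_num)
  have h2 : (2 : ℝ) * N * (1 / 2) ^ V.card ≤ 2 * N := mul_le_of_le_one_right (by positivity) this
  gcongr

/-! ### From an overfull bin to a witness -/

/-- A bin with more than `k + e` balls is witnessed by a binomial tree with `2 ^ k` nodes or by a
forest of such trees with `e` repeats. -/
theorem mem_witness_of_lt_fullest {N R M₀ : ℕ} (hM₀ : 0 < M₀) (k e : ℕ)
    (f : Fin N × Fin 2 → Fin R) {s : State N} (hs : Occurs M₀ (fun x j => (f (x, j) : ℕ)) s)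
    (hl : k + e < fullest (fun x j => (f (x, j) : ℕ)) s) :
    f ∈ treeEvent (fun y => binsAt M₀ y) (2 ^ k) ∨
      ∃ (a : Fin e → Fin (2 ^ k)) (b : Fin e → Fin e × Fin (2 ^ k)),
        f ∈ repeatEvent (fun y => binsAt M₀ y) a b := by
  classical
  set H : Hashes N := fun x j => (f (x, j) : ℕ) with hH
  obtain ⟨r, hr, hrh⟩ := exists_height_of_fullest hs hl
  set c := s.choice
  -- Absent balls get height 0, so the conditions on children are vacuous for them.
  let ht : Fin N → ℕ := fun y => if (y : ℕ) < s.balls then height H M₀ c y else 0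
  have hex : ∀ y : Fin N, ∃ z : ℕ → Fin N,
      (∀ i j, i + 1 < ht y → j + 1 < ht y → z i = z j → i = j) ∧
      ∀ i, i + 1 < ht y → i < ht (z i) ∧
        Hit (fun y : Fin N => binsAt M₀ y) f (y, c y) (z i, c (z i)) := by
    intro y
    by_cases hy : (y : ℕ) < s.balls
    · obtain ⟨z, h1, h2⟩ := exists_hits hM₀ H c hs.invariant.2.2 y hy
      simp only [ht, hy, if_true]
      refine ⟨z, h1, fun i hi => ?_⟩
      have h3 := h2 i hi
      have h4 : (z i : ℕ) < s.balls := lt_trans h3.1 hy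
      simp only [h4, if_true]
      exact ⟨h3.2.1, h3.1, h3.2.2⟩
    · exact ⟨fun _ => y, by simp [ht, hy], by simp [ht, hy]⟩
  choose ch hinj hch using hex
  have hch1 : ∀ y i, i + 1 < ht y → i < ht (ch y i) := fun y i hi => (hch y i hi).1
  have hlt : ∀ y i, i + 1 < ht y → ch y i < y := fun y i hi => (hch y i hi).2.1
  have hht : k + e < ht r := by simpa [ht, hr] using hrh
  -- The children numbered `k, …, k + e - 1` of a ball of height above `k + e` all have height above
  -- `k`.
  let root : Fin e → Fin N := fun i => ch r (k + i)
  have hidx : ∀ i : Fin e, k + i + 1 < ht r := fun i => by have := i.2; omega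
  have hroot : ∀ i, k < ht (root i) := fun i => by
    have := hch1 r (k + i) (hidx i)
    simp only [root]; omega
  let φ : Option (Fin e × Fin (2 ^ k)) → Fin N := fun t =>
    t.elim r fun x => unfolding ch k (root x.1) x.2
  have hφ0 : ∀ i, φ (some (i, 0)) = root i := fun i => by
    simp [φ, unfolding_zero]
  have hφs : ∀ i (x : Fin (2 ^ k)), φ (some (i, x)) = unfolding ch k (root i) x := fun _ _ => rfl
  have hne0 : ∀ x : Fin (2 ^ k), x ≠ 0 → (x : ℕ) ≠ 0 := fun x hx h => hx (Fin.ext (by simpa using h))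
  have hhit : ∀ i (x : Fin (2 ^ k)), x ≠ 0 → Hit (fun y : Fin N => binsAt M₀ y) f
      (φ (some (i, finParent x)), c (φ (some (i, finParent x))))
      (φ (some (i, x)), c (φ (some (i, x)))) := by
    intro i x hx
    rw [hφs, hφs, unfolding_of_ne _ _ _ (hne0 x hx)]
    exact (hch _ _ (index_lt_height_unfolding hch1 (hroot i) x.2 (hne0 x hx))).2
  have hsib : ∀ i (x y : Fin (2 ^ k)), x ≠ 0 → y ≠ 0 → finParent x = finParent y →
      φ (some (i, x)) = φ (some (i, y)) → x = y := by
    intro i x y hx hy hp h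
    exact Fin.ext (unfolding_injOn_siblings hch1 hinj (hroot i) x.2 y.2 (hne0 x hx) (hne0 y hy)
      (congrArg Fin.val hp) h)
  by_cases hcase : ∃ i, Function.Injective fun x => φ (some (i, x))
  · obtain ⟨i, hi⟩ := hcase
    refine Or.inl (Finset.mem_filter.2 ⟨Finset.mem_univ _,
      fun t => (φ (some (i, t)), c (φ (some (i, t)))), hi, hhit i⟩)
  · right
    obtain ⟨a, b, h1, h2⟩ := exists_repeats φ
      (fun i j h => by
        rw [hφ0, hφ0] at h
        exact Fin.ext (Nat.add_left_cancel (hinj r _ _ (hidx i) (hidx j) h)))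
      -- Labels get older along edges, so the ball `r` does not recur.
      (fun x => ((unfolding_le hch1 hlt (hroot x.1) x.2 x.2.2).trans_lt (hlt r _ (hidx x.1))).ne)
      (fun i hi => hcase ⟨i, hi⟩) e le_rfl
    refine ⟨a, b, Finset.mem_filter.2 ⟨Finset.mem_univ _, fun i => ?_,
      fun t => (φ t, c (φ t)), h1, fun t ht hne => ?_, fun i => ?_⟩⟩
    · obtain ⟨ha, hb, hab⟩ := h2 i i.2
      refine ⟨ha, hb, fun hbi hb0 hp => ?_⟩
      have h3 : b i = (i, (b i).2) := Prod.ext hbi rfl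
      rw [h3] at hab
      have h4 := hsib i _ _ hb0 ha hp hab
      have h5 := ((some_mem_seen.1 hb).resolve_left hb0).2
      rw [hbi, h4] at h5
      exact lt_irrefl _ h5
    · rcases t with _ | ⟨i, x⟩
      · exact absurd rfl hne
      · by_cases hx : x = 0
        · subst hx
          simp only [forestParent, if_true, hφ0]
          exact (hch r _ (hidx i)).2
        · simp only [forestParent, hx, if_false]
          exact hhit i x hx
    · obtain ⟨ha, hb, hab⟩ := h2 i i.2
      -- The cut node `a i` carries the ball of `b i`, so the edge into it is a second hit on that
      -- ball.
      simp only [hab]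
      exact hhit i (a i) ha

open Classical in
/-- The hash values for which some bin contains more than `l` balls at some moment. -/
noncomputable def overfull (N R M₀ l : ℕ) : Finset (Fin N × Fin 2 → Fin R) :=
  Finset.univ.filter fun f => ∃ s : State N, Occurs M₀ (fun x j => (f (x, j) : ℕ)) s ∧
    l < fullest (fun x j => (f (x, j) : ℕ)) s

/-- Union bound over the tree event and all shapes `(a, b)` of repeats. -/
theorem card_overfull_le {N M₀ K : ℕ} (hM₀ : 0 < M₀) (hK : 4 * N ≤ M₀ * 2 ^ K) (k e : ℕ) :
    ((overfull N (M₀ * 2 ^ K) M₀ (k + e)).card : ℝ) ≤ ((M₀ * 2 ^ K : ℕ) : ℝ) ^ (2 * N) *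
      (2 * N * (1 / 2) ^ (2 ^ k - 1) +
        (2 ^ k) ^ e * (e * 2 ^ k) ^ e * (2 * N * (1 / (M₀ : ℝ)) ^ e)) := by
  classical
  let m : Fin N → ℕ := fun y => binsAt M₀ y
  have hmR : ∀ y, m y ∣ M₀ * 2 ^ K := fun y => binsAt_dvd (by have := y.2; omega)
  have hm4 : ∀ y : Fin N, 4 * (y : ℕ) ≤ m y := fun y => four_mul_le_binsAt hM₀ _
  have hmM : ∀ y, M₀ ≤ m y := fun y => le_binsAt _ _
  let Sh := (Fin e → Fin (2 ^ k)) × (Fin e → Fin e × Fin (2 ^ k))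
  have hsub : overfull N (M₀ * 2 ^ K) M₀ (k + e) ⊆ treeEvent m (2 ^ k) ∪
      (Finset.univ : Finset Sh).biUnion fun x => repeatEvent m x.1 x.2 := by
    intro f hf
    obtain ⟨s, hs, hl⟩ := (Finset.mem_filter.1 hf).2
    rcases mem_witness_of_lt_fullest hM₀ k e f hs hl with h | ⟨a, b, h⟩
    · exact Finset.mem_union_left _ h
    · exact Finset.mem_union_right _ (Finset.mem_biUnion.2 ⟨(a, b), Finset.mem_univ _, h⟩)
  have hcard : (Fintype.card Sh : ℝ) = (2 ^ k) ^ e * (e * 2 ^ k) ^ e := by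
    simp [Sh, Fintype.card_prod]
  calc ((overfull N (M₀ * 2 ^ K) M₀ (k + e)).card : ℝ)
      ≤ (treeEvent m (2 ^ k) : Finset (Fin N × Fin 2 → Fin (M₀ * 2 ^ K))).card +
        ∑ x : Sh, ((repeatEvent m x.1 x.2 :
          Finset (Fin N × Fin 2 → Fin (M₀ * 2 ^ K))).card : ℝ) := by
        exact_mod_cast (Finset.card_le_card hsub).trans ((Finset.card_union_le _ _).trans
          (Nat.add_le_add_left Finset.card_biUnion_le _))
    _ ≤ ((M₀ * 2 ^ K : ℕ) : ℝ) ^ (2 * N) * (2 * N * (1 / 2) ^ (2 ^ k - 1)) +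
        ∑ _x : Sh, ((M₀ * 2 ^ K : ℕ) : ℝ) ^ (2 * N) * (2 * N * (1 / (M₀ : ℝ)) ^ e) :=
        add_le_add (card_treeEvent_le hM₀ m hmR hm4 hmM)
          (Finset.sum_le_sum fun x _ => card_repeatEvent_le hM₀ m hmR hm4 hmM x.1 x.2)
    _ = _ := by
        rw [Finset.sum_const, Finset.card_univ, nsmul_eq_mul, hcard]
        ring

/-! ### Passage to probabilities and asymptotic estimates -/

theorem measureReal_mem_finset {Ω ι : Type*} [MeasurableSpace Ω] [Fintype ι] [DecidableEq ι]
    (P : Measure Ω) [IsProbabilityMeasure P] {R : ℕ} (X : ι → Ω → Fin R)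
    (hX : ∀ i, Measurable (X i)) (hindep : iIndepFun X P)
    (hunif : ∀ i r, P.real {ω | X i ω = r} = 1 / (R : ℝ)) (B : Finset (ι → Fin R)) :
    P.real {ω | (fun i => X i ω) ∈ B} = B.card / (R : ℝ) ^ Fintype.card ι := by
  have hF : Measurable fun ω i => X i ω := measurable_pi_lambda _ hX
  have h1 : ∀ f : ι → Fin R, P.real ((fun ω i => X i ω) ⁻¹' {f}) =
      1 / (R : ℝ) ^ Fintype.card ι := by
    intro f
    have h2 : (fun ω i => X i ω) ⁻¹' {f} = ⋂ i ∈ Finset.univ, X i ⁻¹' {f i} := by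
      ext ω; simp [funext_iff]
    rw [h2, measureReal_def, hindep.measure_inter_preimage_eq_mul Finset.univ
      (fun i _ => measurableSet_singleton _), ENNReal.toReal_prod]
    have h3 : ∀ i, (P (X i ⁻¹' {f i})).toReal = 1 / (R : ℝ) := fun i => hunif i (f i)
    simp [h3]
  have h2 : {ω | (fun i => X i ω) ∈ B} = (fun ω i => X i ω) ⁻¹' (B : Set (ι → Fin R)) := rfl
  rw [h2, ← sum_measureReal_preimage_singleton B
    (fun f _ => hF (measurableSet_singleton _)), Finset.sum_congr rfl fun f _ => h1 f,
    Finset.sum_const, nsmul_eq_mul, mul_one_div]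

theorem loglog_three_pos : 0 < Real.log (Real.log 3) := by
  refine Real.log_pos ?_
  rw [Real.lt_log_iff_exp_lt (by norm_num)]
  exact lt_trans Real.exp_one_lt_d9 (by norm_num)

theorem fullest_le {N : ℕ} (H : Hashes N) (s : State N) : fullest H s ≤ N :=
  Finset.sup_le fun _ _ => (Finset.card_filter_le _ _).trans (by simp)

/-- A tree size that is at least a given multiple of the binary logarithm of `N`. -/
theorem exists_tree_size (g N : ℕ) (hN : 3 ≤ N) : ∃ k : ℕ,
    (N : ℝ) ^ g ≤ 2 ^ (2 ^ k - 1) ∧ (2 : ℝ) ^ k ≤ (6 * g + 4) * Real.log N := by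
  -- The summand 1 accounts for the root, which has no edge. Rounding up to a power of two at most
  -- doubles `n`.
  let n := g * (Nat.log 2 N + 1) + 1
  have hlog : 1 < Real.log N := by
    have h3 : (3 : ℝ) ≤ N := by exact_mod_cast hN
    refine lt_of_lt_of_le ?_ (Real.log_le_log (by norm_num) h3)
    rw [Real.lt_log_iff_exp_lt (by norm_num)]
    exact lt_trans Real.exp_one_lt_d9 (by norm_num)
  refine ⟨Nat.clog 2 n, ?_, ?_⟩
  · have h1 : n ≤ 2 ^ Nat.clog 2 n := Nat.le_pow_clog (by norm_num) n
    have h2 : N ≤ 2 ^ (Nat.log 2 N + 1) := (Nat.lt_pow_succ_log_self (by norm_num) N).le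
    have h3 : N ^ g ≤ 2 ^ (2 ^ Nat.clog 2 n - 1) := by
      calc N ^ g ≤ (2 ^ (Nat.log 2 N + 1)) ^ g := Nat.pow_le_pow_left h2 g
        _ = 2 ^ (n - 1) := by rw [← pow_mul, mul_comm]; simp [n]
        _ ≤ _ := Nat.pow_le_pow_right (by norm_num) (by omega)
    exact_mod_cast h3
  · have h1 : 2 ^ Nat.clog 2 n ≤ 2 * n := by
      rcases Nat.eq_zero_or_pos (Nat.clog 2 n) with h | h
      · rw [h]; simp [n]; omega
      · have := Nat.pow_pred_clog_lt_self (b := 2) (by norm_num) (x := n) (by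
          by_contra hn
          have : n ≤ 1 := by omega
          rw [Nat.clog_of_right_le_one this] at h
          exact lt_irrefl _ h)
        have h2 : 2 ^ Nat.clog 2 n = 2 * 2 ^ (Nat.clog 2 n).pred := by
          rw [← pow_succ', Nat.pred_eq_sub_one, Nat.sub_add_cancel h]
        omega
    have h2 : (2 : ℝ) ^ Nat.clog 2 n ≤ 2 * (g * (Nat.log 2 N + 1) + 1) := by exact_mod_cast h1
    have h3 : ((Nat.log 2 N : ℕ) : ℝ) ≤ 2 * Real.log N := by
      have h4 : ((Nat.log 2 N : ℕ) : ℝ) * Real.log 2 ≤ Real.log N := by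
        rw [← Real.log_pow]
        refine Real.log_le_log (by positivity) ?_
        exact_mod_cast Nat.pow_log_le_self 2 (by omega)
      have h5 : (1 / 2 : ℝ) < Real.log 2 := by linarith [Real.log_two_gt_d9]
      have h6 : (0 : ℝ) ≤ ((Nat.log 2 N : ℕ) : ℝ) := by positivity
      nlinarith
    have h4 : (g : ℝ) * (Nat.log 2 N + 1) ≤ g * (3 * Real.log N) :=
      mul_le_mul_of_nonneg_left (by linarith) (by positivity)
    linarith

/-- Polylogarithmic factors are eventually negligible. -/
theorem eventually_mul_log_pow_le (W : ℝ) (hW : 0 ≤ W) (n : ℕ) :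
    ∃ N₀ : ℕ, ∀ N : ℕ, N₀ ≤ N → W * Real.log N ^ n ≤ N := by
  have h := (Real.isLittleO_pow_log_id_atTop (n := n)).bound (show (0 : ℝ) < 1 / (W + 1) by positivity)
  obtain ⟨N₀, hN₀⟩ := Filter.eventually_atTop.1 (tendsto_natCast_atTop_atTop.eventually h)
  refine ⟨N₀, fun N hN => ?_⟩
  have h1 := (le_abs_self _).trans (hN₀ N hN)
  simp only [id, Real.norm_eq_abs, Nat.abs_cast] at h1
  rw [one_div, inv_mul_eq_div, le_div_iff₀ (by positivity)] at h1
  have h2 : 0 ≤ Real.log N ^ n := pow_nonneg (Real.log_natCast_nonneg N) _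
  nlinarith

/-- Each of the two terms is at most half of the target. The exponent `g + 3` leaves room for the
factor `2 * N` and, in the second term, for the polylogarithmic number of shapes, which is at most
`N` for large `N`. -/
theorem failure_le (A : ℝ) (d g : ℕ) :
    ∃ N₀ : ℕ, ∀ N k M₀ : ℕ, 3 ≤ N → N₀ ≤ N → 1 ≤ M₀ → (N : ℝ) ≤ A * (M₀ : ℝ) ^ d →
      (N : ℝ) ^ (g + 3) ≤ 2 ^ (2 ^ k - 1) →
      (2 : ℝ) ^ k ≤ (6 * (g + 3 : ℕ) + 4) * Real.log N →
      2 * N * (1 / 2) ^ (2 ^ k - 1) +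
        (2 ^ k) ^ ((d + 1) * (g + 3)) * (((d + 1) * (g + 3) : ℕ) * 2 ^ k) ^ ((d + 1) * (g + 3)) *
          (2 * N * (1 / (M₀ : ℝ)) ^ ((d + 1) * (g + 3))) ≤ 1 / (N : ℝ) ^ g := by
  set e := (d + 1) * (g + 3) with he
  set B : ℝ := 6 * (g + 3 : ℕ) + 4
  have hB : 0 ≤ B := by positivity
  obtain ⟨N₀, hN₀⟩ := eventually_mul_log_pow_le (B ^ e * (e * B) ^ e * (4 * |A| ^ (g + 3)))
    (by positivity) (e + e)
  refine ⟨N₀, fun N k M₀ h3 hN hM₀ hA h1 h2 => ?_⟩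
  have hN3 : (3 : ℝ) ≤ N := by exact_mod_cast h3
  have hM1 : (1 : ℝ) ≤ M₀ := by exact_mod_cast hM₀
  have hNpos : (0 : ℝ) < N := by linarith
  have hApos : 0 < A := by
    by_contra hneg
    have : A * (M₀ : ℝ) ^ d ≤ 0 := mul_nonpos_of_nonpos_of_nonneg (not_lt.1 hneg) (by positivity)
    linarith
  have hW := hN₀ N hN
  rw [abs_of_pos hApos] at hW
  have hlog : 0 ≤ Real.log N := Real.log_natCast_nonneg N
  have hg : (0 : ℝ) < (N : ℝ) ^ g := by positivity
  have hfirst : 2 * (N : ℝ) * (1 / 2) ^ (2 ^ k - 1) ≤ 1 / 2 * (1 / (N : ℝ) ^ g) := by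
    have h4 : ((1 : ℝ) / 2) ^ (2 ^ k - 1) ≤ 1 / (N : ℝ) ^ (g + 3) := by
      rw [one_div_pow]
      exact one_div_le_one_div_of_le (by positivity) h1
    calc 2 * (N : ℝ) * (1 / 2) ^ (2 ^ k - 1) ≤ 2 * (N : ℝ) * (1 / (N : ℝ) ^ (g + 3)) := by gcongr
      _ = 2 / (N : ℝ) ^ 2 * (1 / (N : ℝ) ^ g) := by
        rw [pow_add]; field_simp
      _ ≤ 1 / 2 * (1 / (N : ℝ) ^ g) := by
        refine mul_le_mul_of_nonneg_right ?_ (by positivity)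
        rw [div_le_div_iff₀ (by positivity) (by norm_num)]
        nlinarith
  -- Here `e = (d + 1) * (g + 3)` is used: `M₀ ^ (d + 1) ≥ N / A`, raised to the power `g + 3`.
  have hM : (1 / (M₀ : ℝ)) ^ e ≤ A ^ (g + 3) / (N : ℝ) ^ (g + 3) := by
    rw [he, pow_mul, ← div_pow]
    refine pow_le_pow_left₀ (by positivity) ?_ _
    rw [one_div_pow, div_le_div_iff₀ (by positivity) hNpos, one_mul]
    exact hA.trans (mul_le_mul_of_nonneg_left (pow_le_pow_right₀ hM1 (Nat.le_succ d)) hApos.le)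
  have hsecond : ((2 : ℝ) ^ k) ^ e * ((e : ℕ) * 2 ^ k) ^ e * (2 * N * (1 / (M₀ : ℝ)) ^ e) ≤
      1 / 2 * (1 / (N : ℝ) ^ g) := by
    calc ((2 : ℝ) ^ k) ^ e * ((e : ℕ) * 2 ^ k) ^ e * (2 * N * (1 / (M₀ : ℝ)) ^ e)
        ≤ (B * Real.log N) ^ e * (e * (B * Real.log N)) ^ e *
          (2 * N * (A ^ (g + 3) / (N : ℝ) ^ (g + 3))) := by gcongr
      _ = (B ^ e * (e * B) ^ e * (4 * A ^ (g + 3)) * Real.log N ^ (e + e)) *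
          (N / (2 * (N : ℝ) ^ (g + 3))) := by
        rw [← mul_assoc (e : ℝ), mul_pow _ (Real.log N), mul_pow _ (Real.log N), pow_add _ e e]
        ring
      _ ≤ N * (N / (2 * (N : ℝ) ^ (g + 3))) := by gcongr
      _ = 1 / N * (1 / 2 * (1 / (N : ℝ) ^ g)) := by
        rw [pow_add]; field_simp
      _ ≤ _ := mul_le_of_le_one_left (by positivity) (by
        rw [div_le_one hNpos]; linarith)
  linarith

end SplittingBins

/-! ### Choice of the constant and conclusion -/

theorem mainTheorem2 (A : ℝ) (d : ℕ) (c : ℝ) (hc : 0 < c) :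
    ∃ C : ℝ, 0 < C ∧
      ∀ (M₀ N K : ℕ), 1 ≤ M₀ → 3 ≤ N → (N : ℝ) ≤ A * (M₀ : ℝ) ^ d → 4 * N ≤ M₀ * 2 ^ K →
      ∀ {Ω : Type*} [MeasurableSpace Ω] (P : Measure Ω) [IsProbabilityMeasure P]
        (h : Fin N → Fin 2 → Ω → Fin (M₀ * 2 ^ K)),
        (∀ x j, Measurable (h x j)) →
        iIndepFun (fun p : Fin N × Fin 2 => h p.1 p.2) P →
        (∀ x j r, P.real {ω | h x j ω = r} = 1 / ((M₀ * 2 ^ K : ℕ) : ℝ)) →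
        1 - 1 / (N : ℝ) ^ c ≤
          P.real {ω | ∀ s : SplittingBins.State N,
            SplittingBins.Occurs M₀ (fun x j => (h x j ω : ℕ)) s →
            (SplittingBins.fullest (fun x j => (h x j ω : ℕ)) s : ℝ) ≤
              C * Real.log (Real.log N)} := by
  classical
  obtain ⟨g, hg⟩ := exists_nat_ge c
  obtain ⟨N₀, hN₀⟩ := SplittingBins.failure_le A d g
  set e := (d + 1) * (g + 3) with he
  set B : ℝ := 6 * (g + 3 : ℕ) + 4 with hB
  set τ := Real.log (Real.log 3) with hτ
  have hτpos : 0 < τ := SplittingBins.loglog_three_pos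
  have hB1 : 1 ≤ B := by
    have : (0 : ℝ) ≤ ((g + 3 : ℕ) : ℝ) := by positivity
    linarith
  have hlogB : 0 ≤ Real.log B := Real.log_nonneg hB1
  have hlog2 : 0 < Real.log 2 := Real.log_pos (by norm_num)
  -- The summands pay for `k`, for `e`, and for all `N < N₀`. Constants are absorbed by dividing by
  -- `τ`, the least value of `log log N` for `N ≥ 3`.
  refine ⟨(Real.log B / τ + 1) / Real.log 2 + e / τ + N₀ / τ, by positivity, ?_⟩
  intro M₀ N K hM₀ hN hA hK Ω _ P _ h hmeas hindep hunif
  have hN3 : (3 : ℝ) ≤ N := by exact_mod_cast hN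
  have hlog3 : 0 < Real.log 3 := Real.log_pos (by norm_num)
  have hτN : τ ≤ Real.log (Real.log N) :=
    Real.log_le_log hlog3 (Real.log_le_log (by norm_num) hN3)
  have hlogN : 0 < Real.log N := Real.log_pos (by linarith)
  have hscale : ∀ x : ℝ, 0 ≤ x → x ≤ x / τ * Real.log (Real.log N) := fun x hx => by
    rw [div_mul_eq_mul_div, le_div_iff₀ hτpos]
    exact mul_le_mul_of_nonneg_left hτN hx
  set LL := Real.log (Real.log N) with hLL
  have hLLpos : 0 < LL := hτpos.trans_le hτN
  -- For small `N` the trivial bound by the number of balls suffices.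
  rcases lt_or_ge N N₀ with hlt | hge
  · have huniv : {ω | ∀ s : SplittingBins.State N,
        SplittingBins.Occurs M₀ (fun x j => (h x j ω : ℕ)) s →
        (SplittingBins.fullest (fun x j => (h x j ω : ℕ)) s : ℝ) ≤
          ((Real.log B / τ + 1) / Real.log 2 + e / τ + N₀ / τ) * LL} = Set.univ := by
      refine Set.eq_univ_of_forall fun ω s _ => ?_
      have h1 : (SplittingBins.fullest (fun x j => (h x j ω : ℕ)) s : ℝ) ≤ N₀ := by
        exact_mod_cast (SplittingBins.fullest_le _ _).trans hlt.le
      have h2 : 0 ≤ ((Real.log B / τ + 1) / Real.log 2 + e / τ) * LL := by positivity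
      have h3 := hscale N₀ (by positivity)
      rw [add_mul]
      linarith
    rw [huniv, probReal_univ]
    have : (0 : ℝ) ≤ 1 / (N : ℝ) ^ c := by positivity
    linarith
  · obtain ⟨k, hk1, hk2⟩ := SplittingBins.exists_tree_size (g + 3) N hN
    have hfail := hN₀ N k M₀ hN hge hM₀ hA hk1 hk2
    have hkle : ((k + e : ℕ) : ℝ) ≤ ((Real.log B / τ + 1) / Real.log 2 + e / τ + N₀ / τ) * LL := by
      have h1 : (k : ℝ) * Real.log 2 ≤ Real.log B + LL := by
        rw [← Real.log_pow, hLL, ← Real.log_mul (by linarith) hlogN.ne']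
        exact Real.log_le_log (by positivity) hk2
      have h2 : (k : ℝ) ≤ (Real.log B / τ + 1) / Real.log 2 * LL := by
        rw [div_mul_eq_mul_div, le_div_iff₀ hlog2, add_mul, one_mul]
        exact h1.trans (by linarith [hscale _ hlogB])
      have h3 := hscale e (by positivity)
      have h4 : 0 ≤ (N₀ : ℝ) / τ * LL := by positivity
      push_cast
      rw [add_mul, add_mul]
      linarith
    have hR : (0 : ℝ) < ((M₀ * 2 ^ K : ℕ) : ℝ) := by
      have : 0 < M₀ * 2 ^ K := by omega
      exact_mod_cast this
    have hX : ∀ p : Fin N × Fin 2, Measurable (h p.1 p.2) := fun p => hmeas _ _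
    have hbad := SplittingBins.measureReal_mem_finset P (fun p : Fin N × Fin 2 => h p.1 p.2) hX
      hindep (fun p r => hunif p.1 p.2 r) (SplittingBins.overfull N (M₀ * 2 ^ K) M₀ (k + e))
    have hcard := SplittingBins.card_overfull_le (N := N) hM₀ hK k e
    rw [Fintype.card_prod, Fintype.card_fin, Fintype.card_fin, mul_comm N 2] at hbad
    have hbad' : P.real {ω | (fun p : Fin N × Fin 2 => h p.1 p.2 ω) ∈
        SplittingBins.overfull N (M₀ * 2 ^ K) M₀ (k + e)} ≤ 1 / (N : ℝ) ^ c := by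
      rw [hbad, div_le_iff₀ (by positivity), mul_comm (1 / (N : ℝ) ^ c)]
      refine hcard.trans (mul_le_mul_of_nonneg_left (hfail.trans ?_) (by positivity))
      refine one_div_le_one_div_of_le (by positivity) ?_
      rw [← Real.rpow_natCast (N : ℝ) g]
      exact Real.rpow_le_rpow_of_exponent_le (by linarith) hg
    have hmeasBad : MeasurableSet {ω | (fun p : Fin N × Fin 2 => h p.1 p.2 ω) ∈
        SplittingBins.overfull N (M₀ * 2 ^ K) M₀ (k + e)} :=
      (measurable_pi_lambda _ hX) (Finset.measurableSet _)
    calc 1 - 1 / (N : ℝ) ^ c ≤ P.real {ω | (fun p : Fin N × Fin 2 => h p.1 p.2 ω) ∈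
          SplittingBins.overfull N (M₀ * 2 ^ K) M₀ (k + e)}ᶜ := by
          rw [probReal_compl_eq_one_sub hmeasBad]
          linarith
      _ ≤ _ := by
        refine measureReal_mono fun ω hω s hs => le_trans ?_ hkle
        rw [Nat.cast_le]
        by_contra hlt
        exact hω (Finset.mem_filter.2 ⟨Finset.mem_univ _, s, hs, not_le.1 hlt⟩)
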